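/- Let $r\ge 3$ be an integer and $0<\gamma<1$. A player with integer-valued capital plays two coin-tossing games, winning one unit with heads and losing one unit with tails. Game $A$ uses a fair coin. Game $B$ with parameter $\rho\in[0,1)$ uses a coin with probability of heads $p_0=\rho^{r-1}/(1+\rho^{r-1})$ if the current capital is a multiple of $r$, and a coin with probability of heads $p_1=1/(1+\rho)$ otherwise; we take $\rho=0$, so that $p_0=0$ and $p_1=1$. In the random mixture $\gamma A+(1-\gamma)B$, at each turn, independently of the past, game $A$ is played with probability $\gamma$ and game $B$ is played otherwise. Let $\mathbf P=\gamma\mathbf P_A+(1-\gamma)\mathbf P_B$ be the $r\times r$ transition matrix of the capital modulo $r$, let $\mathbf W$ be the $r\times r$ payoff matrix, with $W_{ij}=1$ if $j\equiv i+1$, $W_{ij}=-1$ if $j\equiv i-1 \pmod r$ and $W_{ij}=0$ otherwise, and put $$ \mu:=\frac{r\gamma(1-\gamma)(2-\gamma)\,[(2-\gamma)^{r-2}-\gamma^{r-2}]}{2[(2-\gamma)^{r}-\gamma^{r}]+r\gamma(2-\gamma)\,[(2-\gamma)^{r-2}-\gamma^{r-2}]}. $$ Then $\mathbf P$ has a unique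 stationary distribution $\boldsymbol\pi$, the mean profit per game at stationarity $\boldsymbol\pi(\mathbf P\circ\mathbf W)\mathbf 1$ (where $\circ$ is the entrywise product) equals $\mu$, and the rate of profit of $\gamma A+(1-\gamma)B$ is $\mu$, regardless of the initial capital: if $S_n$ is the cumulative profit after $n$ games, then $S_n/n\to\mu$ almost surely, for every (possibly random) integer initial capital. -/

import Mathlib

open Filter Topology MeasureTheory
open scoped Matrix

namespace Parrondo

/-- The two games. -/
inductive Game
  | A
  | B

/-- Probability of heads for the coin used in game `B` when capital is a multiple of `r`. -/
noncomputable def p0 (r : ℕ) (ρ : ℝ) : ℝ := ρ ^ (r - 1) / (1 + ρ ^ (r - 1))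

/-- Probability of heads for the coin used in game `B` when capital is not a multiple of `r`. -/
noncomputable def p1 (ρ : ℝ) : ℝ := 1 / (1 + ρ)

/-- Probability of heads when the given game is played with current capital `x`. -/
noncomputable def headsProb (r : ℕ) (ρ : ℝ) : Game → ℤ → ℝ
  | Game.A, _ => 1 / 2
  | Game.B, x => if (r : ℤ) ∣ x then p0 r ρ else p1 ρ

/-- Probability that the given game is the one selected at a turn of `γA + (1-γ)B`. -/
noncomputable def selectProb (γ : ℝ) : Game → ℝ
  | Game.A => γ
  | Game.B => 1 - γ

/-- The probability of an outcome (`true` is heads, `false` is tails) of a toss of a `p`-coin. -/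
noncomputable def tossProb (p : ℝ) (b : Bool) : ℝ := if b then p else 1 - p

/-- The player wins one unit with heads and loses one unit with tails. -/
def profit (b : Bool) : ℤ := if b then 1 else -1

/-- The capital after the first `n` games when the initial capital is `x` and the
tosses are `h 0, h 1, …`. -/
def capitalAfter (x : ℤ) (h : ℕ → Bool) (n : ℕ) : ℤ := x + ∑ k ∈ Finset.range n, profit (h k)

/-- `capital`, `game`, `toss` describe, on the probability space `(Ω, P)`, a player repeatedly
playing the random mixture `γA + (1-γ)B`, starting from an arbitrary (possibly random) integer
capital `capital 0`. At turn `n` the game `game n` is selected and the coin of that game shows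
`toss n`; given everything that happened before, game `A` is selected with probability `γ` and
game `B` otherwise, and the coin then shows heads with the probability that the selected game
prescribes at the current capital. -/
structure IsRandomMixture {Ω : Type*} [MeasurableSpace Ω] (r : ℕ) (ρ γ : ℝ) (P : Measure Ω)
    (capital : ℕ → Ω → ℤ) (game : ℕ → Ω → Game) (toss : ℕ → Ω → Bool) : Prop where
  measurable_initial : Measurable (capital 0)
  measurable_game : ∀ n g, MeasurableSet {ω | game n ω = g}
  measurable_toss : ∀ n, Measurable (toss n)
  capital_eq : ∀ n ω, capital (n + 1) ω = capital n ω + profit (toss n ω)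
  law : ∀ (n : ℕ) (x : ℤ) (g : ℕ → Game) (h : ℕ → Bool),
    P.real {ω | capital 0 ω = x ∧ ∀ k < n + 1, game k ω = g k ∧ toss k ω = h k} =
      P.real {ω | capital 0 ω = x ∧ ∀ k < n, game k ω = g k ∧ toss k ω = h k} *
        (selectProb γ (g n) * tossProb (headsProb r ρ (g n) (capitalAfter x h n)) (h n))

/-- `v` is the rate of profit: almost surely, the cumulative profit per game played tends to
`v`. -/
def HasRateOfProfit {Ω : Type*} [MeasurableSpace Ω] (P : Measure Ω) (capital : ℕ → Ω → ℤ)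
    (v : ℝ) : Prop :=
  ∀ᵐ ω ∂P, Tendsto (fun n : ℕ => ((capital n ω - capital 0 ω : ℤ) : ℝ) / (n : ℝ)) atTop (𝓝 v)

/-- The `r × r` transition matrix of the capital modulo `r` when the given game is played. -/
noncomputable def gameMatrix (r : ℕ) (ρ : ℝ) (g : Game) : Matrix (Fin r) (Fin r) ℝ :=
  Matrix.of fun i j =>
    if (j : ℕ) = ((i : ℕ) + 1) % r then headsProb r ρ g ((i : ℕ) : ℤ)
    else if (i : ℕ) = ((j : ℕ) + 1) % r then 1 - headsProb r ρ g ((i : ℕ) : ℤ)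
    else 0

/-- The transition matrix of `γA + (1-γ)B`. -/
noncomputable def mixtureMatrix (r : ℕ) (ρ γ : ℝ) : Matrix (Fin r) (Fin r) ℝ :=
  γ • gameMatrix r ρ Game.A + (1 - γ) • gameMatrix r ρ Game.B

/-- The payoff matrix: `1` for a step up, `-1` for a step down on the `r`-cycle. -/
def payoffMatrix (r : ℕ) : Matrix (Fin r) (Fin r) ℝ :=
  Matrix.of fun i j =>
    if (j : ℕ) = ((i : ℕ) + 1) % r then 1
    else if (i : ℕ) = ((j : ℕ) + 1) % r then -1
    else 0

/-- `π` is a stationary probability distribution of the transition matrix `M`. -/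
def IsStationary {r : ℕ} (M : Matrix (Fin r) (Fin r) ℝ) (π : Fin r → ℝ) : Prop :=
  (∀ i, 0 ≤ π i) ∧ ∑ i, π i = 1 ∧ π ᵥ* M = π

/-- The mean profit per game at `π`: the row vector `π` times the entrywise product of the
transition and payoff matrices times the column vector of ones. -/
noncomputable def meanProfit (r : ℕ) (ρ γ : ℝ) (π : Fin r → ℝ) : ℝ :=
  π ⬝ᵥ ((mixtureMatrix r ρ γ ⊙ payoffMatrix r) *ᵥ (fun _ => 1))

/-- The closed form for the rate of profit at `ρ = 0`. -/
noncomputable def rateFormula (r : ℕ) (γ : ℝ) : ℝ :=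
  (r * γ * (1 - γ) * (2 - γ) * ((2 - γ) ^ (r - 2) - γ ^ (r - 2))) /
    (2 * ((2 - γ) ^ r - γ ^ r) + r * γ * (2 - γ) * ((2 - γ) ^ (r - 2) - γ ^ (r - 2)))

end Parrondo

/-! Everything rests on an explicit bounded solution `f` of the Poisson equation: at every capital,
drift plus expected increment of `f` equals the constant `rateFormula` (`poisson_equation`). Away
from multiples of `r` this is a linear recurrence with characteristic roots 1 and γ/(2-γ), so `f` is
a constant plus a multiple of (γ/(2-γ))^i plus a linear term; `r`-periodicity and the equation at 0
determine the remaining coefficients and the rate.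

Pairing the equation with a stationary π cancels `f` and leaves the mean profit. Along the walk,
profit plus the change of `f` minus the rate is a bounded increment with mean zero given the past. A
second-moment law of large numbers (`ae_tendsto_sum_range_div_of_orthogonal`) sends its averages to
0, and the bounded `f` does not affect the limit.

Existence and uniqueness of π are linear algebra: the maximum principle makes f ↦ Mf - f + f(0)
invertible, and its inverse, read at 0, is the only possible π. -/

namespace Parrondo

/-! ### Stationary distributions of stochastic matrices -/

section Stochastic

variable {r : ℕ} {M : Matrix (Fin r) (Fin r) ℝ}

/-- A stochastic matrix maps a function to one that is at most as large where the function is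
maximal. -/
theorem mulVec_le_of_forall_le (hM0 : ∀ i j, 0 ≤ M i j) (hM1 : ∀ i, ∑ j, M i j = 1)
    {f : Fin r → ℝ} {c : ℝ} (hf : ∀ j, f j ≤ c) (i : Fin r) : (M *ᵥ f) i ≤ c := by
  calc (M *ᵥ f) i = ∑ j, M i j * f j := rfl
    _ ≤ ∑ j, M i j * c := Finset.sum_le_sum fun j _ => mul_le_mul_of_nonneg_left (hf j) (hM0 i j)
    _ = c := by rw [← Finset.sum_mul, hM1, one_mul]

theorem mulVec_const (hM1 : ∀ i, ∑ j, M i j = 1) (c : ℝ) :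
    M *ᵥ (fun _ => c) = fun _ => c := by
  ext i
  change ∑ j, M i j * c = c
  rw [← Finset.sum_mul, hM1, one_mul]

/-- If `M f - f` is a constant `c`, then `c ≤ 0`. -/
theorem const_nonpos_of_mulVec_sub [NeZero r] (hM0 : ∀ i j, 0 ≤ M i j)
    (hM1 : ∀ i, ∑ j, M i j = 1) {f : Fin r → ℝ} {c : ℝ} (hf : ∀ i, c ≤ (M *ᵥ f) i - f i) :
    c ≤ 0 := by
  obtain ⟨i, hi⟩ := Finite.exists_max f
  have := mulVec_le_of_forall_le hM0 hM1 hi i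
  linarith [hf i]

/-- A stochastic matrix whose only harmonic functions are the constants has a unique stationary
distribution. -/
theorem exists_unique_isStationary [NeZero r] (hM0 : ∀ i j, 0 ≤ M i j)
    (hM1 : ∀ i, ∑ j, M i j = 1)
    (harm : ∀ f : Fin r → ℝ, M *ᵥ f = f → ∀ i j, f i = f j) :
    ∃ π, IsStationary M π ∧ ∀ π', IsStationary M π' → π' = π := by
  -- The kernel of M - 1 consists of the constants; adding f(0) removes it.
  let T : (Fin r → ℝ) →ₗ[ℝ] (Fin r → ℝ) :=
    M.mulVecLin - LinearMap.id + LinearMap.pi fun _ => LinearMap.proj 0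
  have hT : ∀ f i, T f i = (M *ᵥ f) i - f i + f 0 := fun f i => rfl
  have hinj : Function.Injective T := by
    rw [injective_iff_map_eq_zero]
    intro f hf
    have h : ∀ i, (M *ᵥ f) i - f i + f 0 = 0 := fun i => by rw [← hT, hf]; rfl
    have h1 : -f 0 ≤ 0 := const_nonpos_of_mulVec_sub hM0 hM1 (f := f) fun i => by linarith [h i]
    have h2 : f 0 ≤ 0 := const_nonpos_of_mulVec_sub hM0 hM1 (f := -f) fun i => by
      rw [Matrix.mulVec_neg, Pi.neg_apply, Pi.neg_apply]; linarith [h i]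
    have h0 : f 0 = 0 := by linarith
    ext i
    rw [harm f (by ext i; linarith [h i]) i 0, h0]; rfl
  let e := LinearEquiv.ofBijective T ⟨hinj, LinearMap.injective_iff_surjective.1 hinj⟩
  -- A stationary π' satisfies π'(T f) = f(0), so integration against it must be this functional.
  let φ : (Fin r → ℝ) →ₗ[ℝ] ℝ := (LinearMap.proj 0).comp e.symm.toLinearMap
  have hφT : ∀ f, φ (T f) = f 0 := fun f => by
    change e.symm (e f) 0 = f 0
    rw [e.symm_apply_apply]
  have hTφ : ∀ g, ∃ f, T f = g ∧ φ g = f 0 := fun g => ⟨e.symm g, e.apply_symm_apply g, rfl⟩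
  have hφ : ∀ g, φ g = ∑ i, φ (Pi.single i 1) * g i := fun g => by
    conv_lhs => rw [← Finset.univ_sum_single g]
    rw [map_sum]
    refine Finset.sum_congr rfl fun i _ => ?_
    rw [show Pi.single i (g i) = g i • (Pi.single i 1 : Fin r → ℝ) by
      rw [← Pi.single_smul, smul_eq_mul, mul_one], map_smul, smul_eq_mul, mul_comm]
  refine ⟨fun i => φ (Pi.single i 1), ⟨fun i => ?_, ?_, ?_⟩, ?_⟩
  · obtain ⟨f, hf, hf0⟩ := hTφ (Pi.single i 1)
    change 0 ≤ φ (Pi.single i 1)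
    rw [hf0]
    have : -f 0 ≤ 0 := const_nonpos_of_mulVec_sub hM0 hM1 (f := f) fun j => by
      have h := hT f j
      have h' : (0 : ℝ) ≤ (Pi.single i 1 : Fin r → ℝ) j :=
        (Pi.single_nonneg.2 zero_le_one : (0 : Fin r → ℝ) ≤ Pi.single i 1) j
      rw [hf] at h
      linarith
    linarith
  · have h1 : T (fun _ => 1) = fun _ => 1 := by
      ext i; rw [hT, mulVec_const hM1]; ring
    have := hφ (fun _ => 1)
    rw [← h1, hφT] at this
    simpa [h1] using this.symm
  · ext j
    -- Subtracting a constant makes the value at 0 vanish, so φ kills M e_j - e_j.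
    have h1 : T (Pi.single j 1 - fun _ => (Pi.single j 1 : Fin r → ℝ) 0)
        = M *ᵥ Pi.single j 1 - Pi.single j 1 := by
      ext i
      rw [hT, Matrix.mulVec_sub, mulVec_const hM1]
      simp
    have h2 := hφT (Pi.single j 1 - fun _ => (Pi.single j 1 : Fin r → ℝ) 0)
    rw [h1, map_sub, hφ (M *ᵥ Pi.single j 1), Pi.sub_apply, sub_self, sub_eq_zero] at h2
    rw [← h2]
    simp [Matrix.vecMul, dotProduct]
  · rintro π' ⟨-, hs, hst⟩
    have key : ∀ g, π' ⬝ᵥ g = φ g := fun g => by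
      obtain ⟨f, hf, hf0⟩ := hTφ g
      have : g = M *ᵥ f - f + fun _ => f 0 := by rw [← hf]; rfl
      rw [hf0, this, dotProduct_add, dotProduct_sub, Matrix.dotProduct_mulVec, hst, sub_self,
        zero_add]
      simp only [dotProduct]
      rw [← Finset.sum_mul, hs, one_mul]
    ext i
    rw [← key, dotProduct_single, mul_one]

end Stochastic

/-! ### The Poisson equation and its explicit solution -/

/-- The probability of heads in the mixture `γA + (1-γ)B` at `ρ = 0` and capital `x`. -/
noncomputable def mixHeads (r : ℕ) (γ : ℝ) (x : ℤ) : ℝ :=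
  if (r : ℤ) ∣ x then γ / 2 else 1 - γ / 2

theorem mix_headsProb {r : ℕ} (hr : 3 ≤ r) (γ : ℝ) (x : ℤ) :
    γ * headsProb r 0 Game.A x + (1 - γ) * headsProb r 0 Game.B x = mixHeads r γ x := by
  -- Needed for `0 ^ (r - 1) = 0`; the convention `0 ^ 0 = 1` would give `p0 = 1 / 2`.
  have : r - 1 ≠ 0 := by omega
  simp only [headsProb, mixHeads, p0, p1, zero_pow this]
  split_ifs <;> ring

theorem mixHeads_pos {r : ℕ} {γ : ℝ} (hγ0 : 0 < γ) (hγ1 : γ < 1) (x : ℤ) :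
    0 < mixHeads r γ x := by
  unfold mixHeads; split_ifs <;> linarith

theorem mixHeads_lt_one {r : ℕ} {γ : ℝ} (hγ0 : 0 < γ) (hγ1 : γ < 1) (x : ℤ) :
    mixHeads r γ x < 1 := by
  unfold mixHeads; split_ifs <;> linarith

/-- The denominator in the closed form for the rate of profit. -/
noncomputable def rateDenom (r : ℕ) (γ : ℝ) : ℝ :=
  2 * ((2 - γ) ^ r - γ ^ r) + r * γ * (2 - γ) * ((2 - γ) ^ (r - 2) - γ ^ (r - 2))

theorem rateDenom_pos {r : ℕ} (hr : 3 ≤ r) {γ : ℝ} (hγ0 : 0 < γ) (hγ1 : γ < 1) :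
    0 < rateDenom r γ := by
  have h1 : γ ^ r < (2 - γ) ^ r := pow_lt_pow_left₀ (by linarith) hγ0.le (by omega)
  have h2 : γ ^ (r - 2) < (2 - γ) ^ (r - 2) := pow_lt_pow_left₀ (by linarith) hγ0.le (by omega)
  have : 0 ≤ r * γ * (2 - γ) * ((2 - γ) ^ (r - 2) - γ ^ (r - 2)) :=
    mul_nonneg (mul_nonneg (mul_nonneg r.cast_nonneg hγ0.le) (by linarith)) (by linarith)
  unfold rateDenom; linarith

/-- The solution of the Poisson equation of the chain, on representatives `0, …, r`. -/
noncomputable def potentialNat (r : ℕ) (γ : ℝ) (i : ℕ) : ℝ :=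
  -2 * (r * ((2 - γ) ^ (r - i) * γ ^ i) + ((2 - γ) ^ r - γ ^ r) * i) / rateDenom r γ

/-- The solution of the Poisson equation of the chain, as an `r`-periodic function of the
capital. -/
noncomputable def potential (r : ℕ) (γ : ℝ) (x : ℤ) : ℝ := potentialNat r γ (x % r).toNat

/-- The linear term is scaled to offset the change of the geometric term over one period. -/
theorem potentialNat_self (r : ℕ) (γ : ℝ) : potentialNat r γ r = potentialNat r γ 0 := by
  unfold potentialNat
  simp only [Nat.sub_self, pow_zero, Nat.sub_zero, Nat.cast_zero]
  ring

theorem potential_emod (r : ℕ) (γ : ℝ) (x : ℤ) : potential r γ (x % r) = potential r γ x := by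
  simp [potential]

/-- The endpoint `i = r` is included because a step up from `r - 1` lands there. -/
theorem potential_natCast {r : ℕ} (hr : 0 < r) (γ : ℝ) {i : ℕ} (hi : i ≤ r) :
    potential r γ i = potentialNat r γ i := by
  unfold potential
  rcases hi.lt_or_eq with h | rfl
  · rw [Int.emod_eq_of_lt (by omega) (by omega), Int.toNat_natCast]
  · simp [potentialNat_self]

theorem potentialNat_interior {r : ℕ} (hr : 3 ≤ r) {γ : ℝ} (hγ0 : 0 < γ) (hγ1 : γ < 1) {i : ℕ}
    (hi : i + 2 ≤ r) :
    (2 * (1 - γ / 2) - 1) + (1 - γ / 2) * potentialNat r γ (i + 2) + γ / 2 * potentialNat r γ i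
      - potentialNat r γ (i + 1) = rateFormula r γ := by
  have hd := (rateDenom_pos hr hγ0 hγ1).ne'
  have hrate : rateFormula r γ = (r * γ * (1 - γ) * (2 - γ) * ((2 - γ) ^ (r - 2) - γ ^ (r - 2)))
    / rateDenom r γ := rfl
  rw [hrate]
  unfold potentialNat
  field_simp
  -- Substituting for `r` removes the truncated subtractions from the exponents, leaving a
  -- polynomial identity.
  obtain ⟨k, rfl⟩ := Nat.exists_eq_add_of_le hi
  rw [show i + 2 + k - i = k + 2 by omega, show i + 2 + k - (i + 1) = k + 1 by omega,
    show i + 2 + k - (i + 2) = k by omega]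
  unfold rateDenom
  rw [show i + 2 + k - 2 = i + k by omega]
  push_cast
  ring

/-- The equation at a multiple of `r`, whose lower neighbour is represented by `r - 1`; this is the
condition that fixes the rate. -/
theorem potentialNat_boundary {r : ℕ} (hr : 3 ≤ r) {γ : ℝ} (hγ0 : 0 < γ) (hγ1 : γ < 1) :
    (2 * (γ / 2) - 1) + γ / 2 * potentialNat r γ 1 + (1 - γ / 2) * potentialNat r γ (r - 1)
      - potentialNat r γ 0 = rateFormula r γ := by
  have hd := (rateDenom_pos hr hγ0 hγ1).ne'
  have hrate : rateFormula r γ = (r * γ * (1 - γ) * (2 - γ) * ((2 - γ) ^ (r - 2) - γ ^ (r - 2)))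
    / rateDenom r γ := rfl
  rw [hrate]
  unfold potentialNat
  field_simp
  obtain ⟨k, rfl⟩ := Nat.exists_eq_add_of_le' hr
  rw [show k + 3 - (k + 3 - 1) = 1 by omega, show k + 3 - 1 = k + 2 by omega]
  unfold rateDenom
  rw [show k + 3 - 2 = k + 1 by omega]
  push_cast
  ring

/-- The Poisson equation: the drift plus the expected increment of the potential is the rate. -/
theorem poisson_equation {r : ℕ} (hr : 3 ≤ r) {γ : ℝ} (hγ0 : 0 < γ) (hγ1 : γ < 1) (x : ℤ) :
    (2 * mixHeads r γ x - 1) + mixHeads r γ x * potential r γ (x + 1)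
      + (1 - mixHeads r γ x) * potential r γ (x - 1) - potential r γ x = rateFormula r γ := by
  have hr0 : (r : ℤ) ≠ 0 := by omega
  have hx0 := Int.emod_nonneg x hr0
  have hx1 := Int.emod_lt_of_pos x (show (0 : ℤ) < r by omega)
  obtain ⟨i, hi⟩ := Int.eq_ofNat_of_zero_le hx0
  have hup : potential r γ (x + 1) = potentialNat r γ (i + 1) := by
    rw [← potential_natCast (by omega) γ (by omega : i + 1 ≤ r), ← potential_emod,
      ← potential_emod r γ ((i + 1 : ℕ) : ℤ), Int.add_emod, hi]
    push_cast
    simp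
  have hid : potential r γ x = potentialNat r γ i := by
    rw [← potential_emod, hi, potential_natCast (by omega) γ (by omega)]
  have hdiv : (r : ℤ) ∣ x ↔ i = 0 := by rw [Int.dvd_iff_emod_eq_zero, hi]; omega
  rcases i with _ | i
  · have hx : x - 1 = ((r - 1 : ℕ) : ℤ) + r * (x / r - 1) := by
      push_cast [Nat.cast_sub (by omega : 1 ≤ r)] at hi ⊢
      linarith [Int.emod_add_mul_ediv x r]
    have hdown : potential r γ (x - 1) = potentialNat r γ (r - 1) := by
      rw [← potential_natCast (by omega) γ (by omega : r - 1 ≤ r), ← potential_emod,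
        ← potential_emod r γ ((r - 1 : ℕ) : ℤ), hx, Int.add_mul_emod_self_left]
    rw [mixHeads, if_pos (hdiv.2 rfl), hup, hid, hdown, ← potentialNat_boundary hr hγ0 hγ1]
  · have hdown : potential r γ (x - 1) = potentialNat r γ i := by
      rw [← potential_natCast (by omega) γ (by omega : i ≤ r), ← potential_emod,
        ← potential_emod r γ (i : ℤ), Int.sub_emod, hi]
      push_cast
      simp
    rw [mixHeads, if_neg (by rw [hdiv]; omega), hup, hid, hdown,
      ← potentialNat_interior hr hγ0 hγ1 (by omega : i + 2 ≤ r)]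
    ring_nf

/-- The potential is bounded. -/
theorem exists_abs_potential_le {r : ℕ} (hr : 3 ≤ r) (γ : ℝ) :
    ∃ K, ∀ x, |potential r γ x| ≤ K := by
  refine ⟨∑ i ∈ Finset.range r, |potentialNat r γ i|, fun x => ?_⟩
  have h1 := Int.emod_lt_of_pos x (show (0 : ℤ) < r by omega)
  exact Finset.single_le_sum (f := fun i => |potentialNat r γ i|) (fun _ _ => abs_nonneg _)
    (Finset.mem_range.2 (by omega))

/-! ### The chain modulo `r` and its mean profit -/

section Matrix

variable {r : ℕ}

/-- The next state on the `r`-cycle. -/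
def cycleNext (hr : 3 ≤ r) (i : Fin r) : Fin r := ⟨(i + 1) % r, Nat.mod_lt _ (by omega)⟩

/-- The previous state on the `r`-cycle. -/
def cyclePrev (hr : 3 ≤ r) (i : Fin r) : Fin r := ⟨(i + (r - 1)) % r, Nat.mod_lt _ (by omega)⟩

theorem succ_mod_eq_ite (i : Fin r) : ((i : ℕ) + 1) % r = if (i : ℕ) + 1 = r then 0 else (i : ℕ) + 1 := by
  split_ifs with h
  · rw [h, Nat.mod_self]
  · exact Nat.mod_eq_of_lt (by omega)

theorem pred_mod_eq_ite (i : Fin r) :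
    ((i : ℕ) + (r - 1)) % r = if (i : ℕ) = 0 then r - 1 else (i : ℕ) - 1 := by
  have := i.2
  split_ifs with h
  · rw [h, zero_add, Nat.mod_eq_of_lt (by omega)]
  · rw [show (i : ℕ) + (r - 1) = ((i : ℕ) - 1) + r by omega, Nat.add_mod_right,
      Nat.mod_eq_of_lt (by omega)]

theorem eq_cycleNext_iff (hr : 3 ≤ r) (i j : Fin r) :
    (j : ℕ) = ((i : ℕ) + 1) % r ↔ j = cycleNext hr i := by
  rw [Fin.ext_iff]; rfl

theorem eq_cyclePrev_iff (hr : 3 ≤ r) (i j : Fin r) :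
    (i : ℕ) = ((j : ℕ) + 1) % r ↔ j = cyclePrev hr i := by
  have hi := i.2
  have hj := j.2
  rw [Fin.ext_iff, succ_mod_eq_ite]
  change _ ↔ (j : ℕ) = ((i : ℕ) + (r - 1)) % r
  rw [pred_mod_eq_ite]
  split_ifs <;> omega

/-- On a cycle of length 2 the two neighbours would coincide, so `3 ≤ r` matters here. -/
theorem cyclePrev_ne_cycleNext (hr : 3 ≤ r) (i : Fin r) : cyclePrev hr i ≠ cycleNext hr i := by
  have hi := i.2
  rw [Ne, Fin.ext_iff]
  change ¬ ((i : ℕ) + (r - 1)) % r = ((i : ℕ) + 1) % r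
  rw [pred_mod_eq_ite, succ_mod_eq_ite]
  split_ifs <;> omega

theorem mixtureMatrix_apply (hr : 3 ≤ r) (γ : ℝ) (i j : Fin r) :
    mixtureMatrix r 0 γ i j = if j = cycleNext hr i then mixHeads r γ (i : ℕ)
      else if j = cyclePrev hr i then 1 - mixHeads r γ (i : ℕ) else 0 := by
  have h1 := eq_cycleNext_iff hr i j
  have h2 := eq_cyclePrev_iff hr i j
  simp only [mixtureMatrix, gameMatrix, Matrix.add_apply, Matrix.smul_apply, Matrix.of_apply,
    smul_eq_mul, h1, h2, ← mix_headsProb hr]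
  split_ifs <;> ring

theorem sum_cycle (hr : 3 ≤ r) (i : Fin r) (a b : ℝ) (f : Fin r → ℝ) :
    ∑ j, (if j = cycleNext hr i then a else if j = cyclePrev hr i then b else 0) * f j
      = a * f (cycleNext hr i) + b * f (cyclePrev hr i) := by
  have h := cyclePrev_ne_cycleNext hr i
  rw [← Finset.sum_subset (Finset.subset_univ {cycleNext hr i, cyclePrev hr i}),
    Finset.sum_pair h.symm]
  · simp [h]
  · intro j _ hj
    simp only [Finset.mem_insert, Finset.mem_singleton, not_or] at hj
    simp [hj.1, hj.2]

theorem mixtureMatrix_mulVec (hr : 3 ≤ r) (γ : ℝ) (f : Fin r → ℝ) (i : Fin r) :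
    (mixtureMatrix r 0 γ *ᵥ f) i = mixHeads r γ (i : ℕ) * f (cycleNext hr i)
      + (1 - mixHeads r γ (i : ℕ)) * f (cyclePrev hr i) := by
  rw [← sum_cycle]
  simp only [Matrix.mulVec, dotProduct, mixtureMatrix_apply hr]

theorem hadamard_payoff_mulVec (hr : 3 ≤ r) (γ : ℝ) (i : Fin r) :
    ((mixtureMatrix r 0 γ ⊙ payoffMatrix r) *ᵥ fun _ => 1) i
      = 2 * mixHeads r γ (i : ℕ) - 1 := by
  have h := sum_cycle hr i (mixHeads r γ (i : ℕ)) (-(1 - mixHeads r γ (i : ℕ)))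
    (fun _ => 1)
  rw [show 2 * mixHeads r γ (i : ℕ) - 1
    = mixHeads r γ (i : ℕ) * 1 + -(1 - mixHeads r γ (i : ℕ)) * 1 by ring, ← h,
    Matrix.mulVec, dotProduct]
  refine Finset.sum_congr (M := ℝ) rfl fun j _ => ?_
  have h1 := eq_cycleNext_iff hr i j
  have h2 := eq_cyclePrev_iff hr i j
  simp only [Matrix.hadamard_apply, mixtureMatrix_apply hr, payoffMatrix, Matrix.of_apply, h1, h2]
  split_ifs <;> ring

theorem mixtureMatrix_nonneg (hr : 3 ≤ r) {γ : ℝ} (hγ0 : 0 < γ) (hγ1 : γ < 1) (i j : Fin r) :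
    0 ≤ mixtureMatrix r 0 γ i j := by
  rw [mixtureMatrix_apply hr]
  have h0 := mixHeads_pos (r := r) hγ0 hγ1 (i : ℕ)
  have h1 := mixHeads_lt_one (r := r) hγ0 hγ1 (i : ℕ)
  split_ifs <;> linarith

theorem mixtureMatrix_row_sum (hr : 3 ≤ r) (γ : ℝ) (i : Fin r) :
    ∑ j, mixtureMatrix r 0 γ i j = 1 := by
  have := mixtureMatrix_mulVec hr γ (fun _ => 1) i
  simpa [Matrix.mulVec, dotProduct] using this

theorem cycleNext_iterate_val (hr : 3 ≤ r) (i : Fin r) (n : ℕ) :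
    (((cycleNext hr)^[n] i : Fin r) : ℕ) = (i + n) % r := by
  induction n with
  | zero => simp [Nat.mod_eq_of_lt i.2]
  | succ n ih =>
    rw [Function.iterate_succ_apply']
    change (((cycleNext hr)^[n] i : Fin r) + 1 : ℕ) % r = _
    rw [ih, Nat.mod_add_mod, add_assoc]

/-- The chain on the cycle is irreducible: its harmonic functions are constant. -/
theorem mixtureMatrix_harmonic (hr : 3 ≤ r) {γ : ℝ} (hγ0 : 0 < γ) (hγ1 : γ < 1)
    (f : Fin r → ℝ) (hf : mixtureMatrix r 0 γ *ᵥ f = f) (i j : Fin r) : f i = f j := by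
  have : NeZero r := ⟨by omega⟩
  obtain ⟨m, hm⟩ := Finite.exists_max f
  -- A maximal value that is an average with positive weight on the next state forces that state to
  -- be maximal too.
  have step : ∀ k, f k = f m → f (cycleNext hr k) = f m := fun k hk => by
    have h := congrFun hf k
    rw [mixtureMatrix_mulVec hr, hk] at h
    have h0 := mixHeads_pos (r := r) hγ0 hγ1 (k : ℕ)
    have h1 := mixHeads_lt_one (r := r) hγ0 hγ1 (k : ℕ)
    refine le_antisymm (hm _) ?_
    nlinarith [mul_nonneg (sub_nonneg.2 h1.le) (sub_nonneg.2 (hm (cyclePrev hr k)))]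
  have iter : ∀ n, f ((cycleNext hr)^[n] m) = f m := fun n => by
    induction n with
    | zero => rfl
    | succ n ih => rw [Function.iterate_succ_apply']; exact step _ ih
  have all : ∀ k, f k = f m := fun k => by
    -- This many steps up from `m` end at `k + r`, that is, at `k`.
    rw [← iter (k + (r - m))]
    congr 1
    ext
    rw [cycleNext_iterate_val, show (m : ℕ) + (k + (r - m)) = k + r by omega, Nat.add_mod_right,
      Nat.mod_eq_of_lt k.2]
  rw [all i, all j]

theorem potential_cycleNext (hr : 3 ≤ r) (γ : ℝ) (i : Fin r) :
    potential r γ ((cycleNext hr i : Fin r) : ℕ) = potential r γ ((i : ℕ) + 1) := by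
  rw [← potential_emod r γ ((i : ℕ) + 1)]
  simp [cycleNext]

theorem potential_cyclePrev (hr : 3 ≤ r) (γ : ℝ) (i : Fin r) :
    potential r γ ((cyclePrev hr i : Fin r) : ℕ) = potential r γ ((i : ℕ) - 1) := by
  rw [← potential_emod r γ ((i : ℕ) - 1)]
  have : ((cyclePrev hr i : Fin r) : ℕ) = ((i : ℕ) + (r - 1)) % r := rfl
  rw [this]
  congr 1
  push_cast [Nat.cast_sub (by omega : 1 ≤ r)]
  rw [show (i : ℤ) + (r - 1) = i - 1 + r by ring, Int.add_emod_right]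

/-- The mean profit at any stationary distribution is the closed form. -/
theorem meanProfit_eq_rateFormula (hr : 3 ≤ r) {γ : ℝ} (hγ0 : 0 < γ) (hγ1 : γ < 1)
    {π : Fin r → ℝ} (hπ : IsStationary (mixtureMatrix r 0 γ) π) :
    meanProfit r 0 γ π = rateFormula r γ := by
  obtain ⟨-, hs, hst⟩ := hπ
  let f : Fin r → ℝ := fun i => potential r γ (i : ℕ)
  -- The Poisson equation in vector form; stationarity then cancels `f` against `M f`.
  have h : ((mixtureMatrix r 0 γ ⊙ payoffMatrix r) *ᵥ fun _ => 1)
      = (fun _ => rateFormula r γ) + f - mixtureMatrix r 0 γ *ᵥ f := by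
    ext i
    have hp := poisson_equation hr hγ0 hγ1 (i : ℕ)
    simp only [Pi.sub_apply, Pi.add_apply, hadamard_payoff_mulVec hr, mixtureMatrix_mulVec hr, f,
      potential_cycleNext, potential_cyclePrev]
    linarith
  rw [meanProfit, h, dotProduct_sub, dotProduct_add, Matrix.dotProduct_mulVec, hst,
    add_sub_cancel_right]
  simp only [dotProduct]
  rw [← Finset.sum_mul, hs, one_mul]

end Matrix

/-! ### A strong law for bounded orthogonal increments -/

section LawOfLargeNumbers

variable {Ω : Type*} [MeasurableSpace Ω] {P : Measure Ω}

theorem abs_sum_range_sub_le {d : ℕ → ℝ} {C : ℝ} (hC : ∀ k, |d k| ≤ C) (m n : ℕ) :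
    |∑ k ∈ Finset.range (m + n), d k| ≤ |∑ k ∈ Finset.range m, d k| + n * C := by
  rw [Finset.sum_range_add]
  refine (abs_add_le _ _).trans (add_le_add le_rfl ?_)
  refine (Finset.abs_sum_le_sum_abs _ _).trans ((Finset.sum_le_sum fun k _ => hC _).trans ?_)
  simp

/-- With k = ⌊√n⌋, at most 2k terms separate n from k², contributing at most 2kC, which is
negligible against k². -/
theorem tendsto_sum_range_div_of_squares {d : ℕ → ℝ} {C : ℝ} (hC : ∀ k, |d k| ≤ C)
    (h : Tendsto (fun k : ℕ => (∑ i ∈ Finset.range (k ^ 2), d i) / (k : ℝ) ^ 2) atTop (𝓝 0)) :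
    Tendsto (fun n : ℕ => (∑ i ∈ Finset.range n, d i) / (n : ℝ)) atTop (𝓝 0) := by
  have hC0 : 0 ≤ C := (abs_nonneg _).trans (hC 0)
  have hsqrt : Tendsto Nat.sqrt atTop atTop :=
    tendsto_atTop_atTop.2 fun b => ⟨b * b, fun a ha => Nat.le_sqrt.2 ha⟩
  have h1 : Tendsto (fun k : ℕ => |(∑ i ∈ Finset.range (k ^ 2), d i) / (k : ℝ) ^ 2|
      + 2 * C / (k : ℝ)) atTop (𝓝 0) := by
    simpa using h.abs.add (tendsto_const_div_atTop_nhds_zero_nat (2 * C))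
  refine squeeze_zero_norm' ?_ (h1.comp hsqrt)
  filter_upwards [eventually_ge_atTop 1] with n hn
  obtain ⟨m, hm⟩ := Nat.exists_eq_add_of_le (Nat.sqrt_le' n)
  have hk : 1 ≤ Nat.sqrt n := Nat.le_sqrt.2 (by simpa using hn)
  have hm2 : m ≤ 2 * Nat.sqrt n := by
    have := Nat.sqrt_le_add n
    rw [pow_two] at hm
    omega
  simp only [Function.comp]
  set k := Nat.sqrt n
  have hk' : (1 : ℝ) ≤ k := by exact_mod_cast hk
  have hn' : (k : ℝ) ^ 2 ≤ n := by exact_mod_cast Nat.sqrt_le' n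
  have hm2' : (m : ℝ) ≤ 2 * k := by exact_mod_cast hm2
  have hb := abs_sum_range_sub_le hC (k ^ 2) m
  rw [← hm] at hb
  rw [Real.norm_eq_abs, abs_div, abs_div, abs_of_nonneg (by positivity : (0 : ℝ) ≤ n),
    abs_of_nonneg (by positivity : (0 : ℝ) ≤ (k : ℝ) ^ 2)]
  calc |∑ i ∈ Finset.range n, d i| / n
      ≤ (|∑ i ∈ Finset.range (k ^ 2), d i| + 2 * k * C) / n := by
        gcongr
        exact hb.trans (by gcongr)
    _ ≤ (|∑ i ∈ Finset.range (k ^ 2), d i| + 2 * k * C) / (k : ℝ) ^ 2 := by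
        gcongr
    _ = _ := by field_simp

/-- Strong law of large numbers for bounded increments, each orthogonal to the sum of the
previous ones. -/
theorem ae_tendsto_sum_range_div_of_orthogonal [IsProbabilityMeasure P] {D : ℕ → Ω → ℝ} {C : ℝ}
    (hD : ∀ k, Measurable (D k)) (hC : ∀ k ω, |D k ω| ≤ C)
    (horth : ∀ n, ∫ ω, (∑ k ∈ Finset.range n, D k ω) * D n ω ∂P = 0) :
    ∀ᵐ ω ∂P, Tendsto (fun n : ℕ => (∑ k ∈ Finset.range n, D k ω) / (n : ℝ)) atTop (𝓝 0) := by
  let S : ℕ → Ω → ℝ := fun n ω => ∑ k ∈ Finset.range n, D k ω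
  have hS : ∀ n, Measurable (S n) := fun n => Finset.measurable_fun_sum _ fun k _ => hD k
  have hSb : ∀ n ω, |S n ω| ≤ n * C := fun n ω => by
    have := abs_sum_range_sub_le (d := fun k => D k ω) (fun k => hC k ω) 0 n
    simpa [S] using this
  have hint : ∀ {f : Ω → ℝ} (K : ℝ), Measurable f → (∀ ω, |f ω| ≤ K) → Integrable f P :=
    fun K hf hK => Integrable.of_bound hf.aestronglyMeasurable K (Eventually.of_forall hK)
  have hbd : ∀ {a b A B : ℝ}, |a| ≤ A → |b| ≤ B → |a * b| ≤ A * B := fun ha hb => by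
    rw [abs_mul]
    exact mul_le_mul ha hb (abs_nonneg _) ((abs_nonneg _).trans ha)
  have hSS : ∀ n, Integrable (fun ω => S n ω * S n ω) P := fun n =>
    hint (n * C * (n * C)) ((hS n).mul (hS n)) fun ω => hbd (hSb n ω) (hSb n ω)
  have hSD : ∀ n, Integrable (fun ω => S n ω * D n ω) P := fun n =>
    hint (n * C * C) ((hS n).mul (hD n)) fun ω => hbd (hSb n ω) (hC n ω)
  have hDD : ∀ n, Integrable (fun ω => D n ω * D n ω) P := fun n =>
    hint (C * C) ((hD n).mul (hD n)) fun ω => hbd (hC n ω) (hC n ω)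
  -- Orthogonality kills the cross term, so the second moment grows at most linearly.
  have hvar : ∀ n, ∫ ω, S n ω * S n ω ∂P ≤ n * C ^ 2 := fun n => by
    induction n with
    | zero => simp [S]
    | succ n ih =>
      have h1 : ∀ ω, S (n + 1) ω * S (n + 1) ω
          = S n ω * S n ω + 2 * (S n ω * D n ω) + D n ω * D n ω := fun ω => by
        simp only [S, Finset.sum_range_succ]; ring
      have h2 : ∫ ω, D n ω * D n ω ∂P ≤ C ^ 2 := by
        calc ∫ ω, D n ω * D n ω ∂P ≤ ∫ _, C ^ 2 ∂P :=
              integral_mono (hDD n) (integrable_const _) fun ω => by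
                have := (le_abs_self _).trans (hbd (hC n ω) (hC n ω))
                simpa [pow_two] using this
          _ = C ^ 2 := by simp
      have h3 : ∫ ω, S (n + 1) ω * S (n + 1) ω ∂P
          = ∫ ω, S n ω * S n ω ∂P + 2 * ∫ ω, S n ω * D n ω ∂P + ∫ ω, D n ω * D n ω ∂P := by
        have h4 : Integrable (fun ω => S n ω * S n ω + 2 * (S n ω * D n ω)) P :=
          (hSS n).add ((hSD n).const_mul 2)
        rw [← integral_const_mul, ← integral_add (hSS n) ((hSD n).const_mul 2),
          ← integral_add h4 (hDD n)]
        exact integral_congr_ae (Eventually.of_forall h1)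
      rw [h3, horth n]
      push_cast
      linarith
  -- Along squares the second moments of the averages are at most C²/k², which is summable; hence
  -- the Y k are almost surely summable and tend to 0.
  let Y : ℕ → Ω → ℝ := fun k ω => (S (k ^ 2) ω / (k : ℝ) ^ 2) ^ 2
  have hY : ∀ k, Measurable fun ω => ENNReal.ofReal (Y k ω) := fun k =>
    (((hS _).div_const _).pow_const 2).ennreal_ofReal
  have hYint : ∀ k, ∫⁻ ω, ENNReal.ofReal (Y k ω) ∂P ≤ ENNReal.ofReal (C ^ 2 / (k : ℝ) ^ 2) :=
    fun k => by
      have hYe : ∀ ω, Y k ω = (S (k ^ 2) ω * S (k ^ 2) ω) * (((k : ℝ) ^ 2) ^ 2)⁻¹ := fun ω => by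
        simp only [Y, div_eq_mul_inv]; ring
      rw [← ofReal_integral_eq_lintegral_ofReal]
      · apply ENNReal.ofReal_le_ofReal
        simp only [hYe]
        rw [integral_mul_const]
        rcases Nat.eq_zero_or_pos k with rfl | hk
        -- At k = 0 both sides are 0, by the convention for division by zero.
        · simp
        · have hk' : (0 : ℝ) < k := by exact_mod_cast hk
          have := hvar (k ^ 2)
          push_cast at this
          calc _ ≤ ((k : ℝ) ^ 2 * C ^ 2) * (((k : ℝ) ^ 2) ^ 2)⁻¹ := by gcongr
            _ = _ := by field_simp
      · exact ((hSS _).mul_const _).congr (Eventually.of_forall fun ω => (hYe ω).symm)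
      · exact Eventually.of_forall fun ω => sq_nonneg _
  have hsum : ∫⁻ ω, ∑' k, ENNReal.ofReal (Y k ω) ∂P ≠ ⊤ := by
    rw [lintegral_tsum fun k => (hY k).aemeasurable]
    refine ne_top_of_le_ne_top ?_ (ENNReal.tsum_le_tsum hYint)
    have hs : Summable fun k : ℕ => C ^ 2 / (k : ℝ) ^ 2 := by
      simpa [div_eq_mul_inv] using
        (Real.summable_nat_pow_inv.2 one_lt_two).mul_left (C ^ 2)
    rw [← ENNReal.ofReal_tsum_of_nonneg (fun k => by positivity) hs]
    exact ENNReal.ofReal_ne_top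
  filter_upwards [ae_lt_top (Measurable.tsum hY) hsum] with ω hω
  refine tendsto_sum_range_div_of_squares (fun k => hC k ω) ?_
  have h1 := ENNReal.tendsto_atTop_zero_of_tsum_ne_top hω.ne
  have h2 : Tendsto (fun k => Y k ω) atTop (𝓝 0) := by
    have := (ENNReal.tendsto_toReal ENNReal.zero_ne_top).comp h1
    refine Tendsto.congr (fun k => ?_) this
    exact ENNReal.toReal_ofReal (sq_nonneg _)
  have h3 := h2.sqrt
  rw [Real.sqrt_zero] at h3
  rw [tendsto_zero_iff_abs_tendsto_zero]
  refine Tendsto.congr (fun k => ?_) h3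
  exact Real.sqrt_sq_eq_abs _

end LawOfLargeNumbers

/-! ### The compensated walk and its rate of profit -/

section Walk

/-- Makes the set of finite histories countable, so that integrals can be split over them. -/
instance : Countable Game :=
  Function.Injective.countable (f := fun g : Game => match g with | .A => true | .B => false)
    fun a b h => by cases a <;> cases b <;> simp_all

/-- The increments of the martingale obtained by compensating the cumulative profit with the
potential. -/
noncomputable def increment {Ω : Type*} (r : ℕ) (γ : ℝ) (capital : ℕ → Ω → ℤ) (n : ℕ) (ω : Ω) : ℝ :=
  ((capital (n + 1) ω - capital n ω : ℤ) : ℝ) + potential r γ (capital (n + 1) ω)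
    - potential r γ (capital n ω) - rateFormula r γ

theorem sum_increment {Ω : Type*} (r : ℕ) (γ : ℝ) (capital : ℕ → Ω → ℤ) (n : ℕ) (ω : Ω) :
    ∑ k ∈ Finset.range n, increment r γ capital k ω
      = ((capital n ω - capital 0 ω : ℤ) : ℝ) + potential r γ (capital n ω)
        - potential r γ (capital 0 ω) - n * rateFormula r γ := by
  induction n with
  | zero => simp
  | succ n ih =>
    rw [Finset.sum_range_succ, ih, increment]
    push_cast
    ring

variable {Ω : Type*} [MeasurableSpace Ω] {P : Measure Ω} {r : ℕ} {ρ γ : ℝ}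
  {capital : ℕ → Ω → ℤ} {game : ℕ → Ω → Game} {toss : ℕ → Ω → Bool}

/-- The event that the initial capital is `x` and that the first `n` games and tosses are as
prescribed. -/
def historySet (capital : ℕ → Ω → ℤ) (game : ℕ → Ω → Game) (toss : ℕ → Ω → Bool) (n : ℕ) (x : ℤ)
    (g : ℕ → Game) (h : ℕ → Bool) : Set Ω :=
  {ω | capital 0 ω = x ∧ ∀ k < n, game k ω = g k ∧ toss k ω = h k}

theorem IsRandomMixture.measurable_capital
    (H : IsRandomMixture r ρ γ P capital game toss) (n : ℕ) : Measurable (capital n) := by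
  induction n with
  | zero => exact H.measurable_initial
  | succ n ih =>
    rw [show capital (n + 1) = fun ω => capital n ω + profit (toss n ω) from
      funext (H.capital_eq n)]
    exact ih.add ((Measurable.of_discrete (f := profit)).comp (H.measurable_toss n))

theorem IsRandomMixture.measurableSet_historySet
    (H : IsRandomMixture r ρ γ P capital game toss) (n : ℕ) (x : ℤ) (g : ℕ → Game) (h : ℕ → Bool) :
    MeasurableSet (historySet capital game toss n x g h) := by
  have : historySet capital game toss n x g h = capital 0 ⁻¹' {x} ∩
      ⋂ k, ⋂ _ : k < n, ({ω | game k ω = g k} ∩ toss k ⁻¹' {h k}) := by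
    ext ω; simp [historySet]
  rw [this]
  exact (H.measurable_initial (measurableSet_singleton _)).inter
    (MeasurableSet.iInter fun k => MeasurableSet.iInter fun _ =>
      (H.measurable_game k _).inter (H.measurable_toss k (measurableSet_singleton _)))

theorem IsRandomMixture.capital_eq_capitalAfter
    (H : IsRandomMixture r ρ γ P capital game toss) {n : ℕ} {x : ℤ} {g : ℕ → Game} {h : ℕ → Bool}
    {ω : Ω} (hω : ω ∈ historySet capital game toss n x g h) {m : ℕ} (hm : m ≤ n) :
    capital m ω = capitalAfter x h m := by
  induction m with
  | zero => simp [capitalAfter, hω.1]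
  | succ m ih =>
    rw [H.capital_eq, ih (by omega), (hω.2 m (by omega)).2]
    simp [capitalAfter, Finset.sum_range_succ, add_assoc]

/-- Given the history, the next toss shows heads with the mixture probability at the current
capital. -/
theorem IsRandomMixture.real_historySet_inter_toss [IsProbabilityMeasure P] (hr : 3 ≤ r)
    (H : IsRandomMixture r 0 γ P capital game toss) (n : ℕ) (x : ℤ) (g : ℕ → Game) (h : ℕ → Bool)
    (b : Bool) :
    P.real (historySet capital game toss n x g h ∩ toss n ⁻¹' {b})
      = P.real (historySet capital game toss n x g h)
        * tossProb (mixHeads r γ (capitalAfter x h n)) b := by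
  -- Overriding the prescribed sequences at index `n` turns `law` into a statement about any next
  -- game and toss; summing over the two games then gives the mixture probability.
  have hset : ∀ a : Game, historySet capital game toss (n + 1) x (Function.update g n a)
      (Function.update h n b)
        = historySet capital game toss n x g h ∩ toss n ⁻¹' {b} ∩ {ω | game n ω = a} := fun a => by
    ext ω
    constructor
    · rintro ⟨h0, hk⟩
      have hn := hk n n.lt_succ_self
      simp only [Function.update_self] at hn
      refine ⟨⟨⟨h0, fun k hkn => ?_⟩, hn.2⟩, hn.1⟩
      have := hk k (by omega)
      rwa [Function.update_of_ne hkn.ne, Function.update_of_ne hkn.ne] at this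
    · rintro ⟨⟨⟨h0, hk⟩, hb⟩, ha⟩
      refine ⟨h0, fun k hkn => ?_⟩
      rcases Nat.lt_succ_iff_lt_or_eq.1 hkn with hlt | rfl
      · rw [Function.update_of_ne hlt.ne, Function.update_of_ne hlt.ne]
        exact hk k hlt
      · simp only [Function.update_self]
        exact ⟨ha, hb⟩
  have hprev : ∀ a : Game, historySet capital game toss n x (Function.update g n a)
      (Function.update h n b) = historySet capital game toss n x g h := fun a => by
    ext ω
    refine and_congr_right fun _ => forall₂_congr fun k hk => ?_
    rw [Function.update_of_ne hk.ne, Function.update_of_ne hk.ne]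
  have hcap : capitalAfter x (Function.update h n b) n = capitalAfter x h n := by
    unfold capitalAfter
    congr 1
    refine Finset.sum_congr rfl fun k hk => ?_
    rw [Function.update_of_ne (Finset.mem_range.1 hk).ne]
  have hlaw : ∀ a : Game,
      P.real (historySet capital game toss n x g h ∩ toss n ⁻¹' {b} ∩ {ω | game n ω = a})
        = P.real (historySet capital game toss n x g h)
          * (selectProb γ a * tossProb (headsProb r 0 a (capitalAfter x h n)) b) := fun a => by
    have := H.law n x (Function.update g n a) (Function.update h n b)
    rw [Function.update_self, Function.update_self, hcap] at this
    rw [← hset a]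
    refine this.trans ?_
    rw [← hprev a]
    rfl
  have hcompl : (historySet capital game toss n x g h ∩ toss n ⁻¹' {b}) \ {ω | game n ω = Game.A}
      = historySet capital game toss n x g h ∩ toss n ⁻¹' {b} ∩ {ω | game n ω = Game.B} := by
    ext ω
    refine and_congr_right fun _ => ?_
    change ¬ game n ω = Game.A ↔ game n ω = Game.B
    cases game n ω <;> simp
  rw [← measureReal_inter_add_sdiff (μ := P) (H.measurable_game n Game.A), hcompl, hlaw, hlaw,
    ← mix_headsProb hr, ← mul_add]
  congr 1
  cases b <;> simp only [selectProb, tossProb] <;> simp <;> ring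

theorem IsRandomMixture.measurable_increment
    (H : IsRandomMixture r ρ γ P capital game toss) (n : ℕ) :
    Measurable (increment r γ capital n) := by
  have hpot : Measurable (potential r γ) := Measurable.of_discrete
  have hcast : Measurable (fun x : ℤ => (x : ℝ)) := Measurable.of_discrete
  exact (((hcast.comp ((H.measurable_capital _).sub (H.measurable_capital _))).add
    (hpot.comp (H.measurable_capital _))).sub (hpot.comp (H.measurable_capital _))).sub_const _

theorem IsRandomMixture.exists_abs_increment_le (hr : 3 ≤ r)
    (H : IsRandomMixture r ρ γ P capital game toss) :
    ∃ C, ∀ n ω, |increment r γ capital n ω| ≤ C := by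
  obtain ⟨K, hK⟩ := exists_abs_potential_le hr γ
  refine ⟨1 + K + K + |rateFormula r γ|, fun n ω => ?_⟩
  have h1 : |((capital (n + 1) ω - capital n ω : ℤ) : ℝ)| ≤ 1 := by
    rw [H.capital_eq, add_sub_cancel_left]
    cases toss n ω <;> simp [profit]
  unfold increment
  refine (abs_sub _ _).trans (add_le_add ((abs_sub _ _).trans (add_le_add
    ((abs_add_le _ _).trans (add_le_add h1 (hK _))) (hK _))) le_rfl)

/-- The increment has mean zero on every history. -/
theorem IsRandomMixture.setIntegral_increment [IsProbabilityMeasure P] (hr : 3 ≤ r)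
    (hγ0 : 0 < γ) (hγ1 : γ < 1) (H : IsRandomMixture r 0 γ P capital game toss) (n : ℕ) (x : ℤ)
    (g : ℕ → Game) (h : ℕ → Bool) :
    ∫ ω in historySet capital game toss n x g h, increment r γ capital n ω ∂P = 0 := by
  have hE := H.measurableSet_historySet n x g h
  have hT : ∀ b, MeasurableSet (toss n ⁻¹' {b}) := fun b =>
    H.measurable_toss n (measurableSet_singleton b)
  set E := historySet capital game toss n x g h with hEdef
  set y := capitalAfter x h n
  let c : Bool → ℝ := fun b => (profit b : ℝ) + potential r γ (y + profit b)
    - potential r γ y - rateFormula r γ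
  have hval : ∀ b, ∀ ω ∈ E ∩ toss n ⁻¹' {b}, increment r γ capital n ω = c b := by
    rintro b ω ⟨hω, hb⟩
    have hb' : toss n ω = b := hb
    rw [increment, H.capital_eq, H.capital_eq_capitalAfter hω le_rfl, hb', add_sub_cancel_left]
  have hpart : ∀ b, ∫ ω in E ∩ toss n ⁻¹' {b}, increment r γ capital n ω ∂P
      = P.real E * tossProb (mixHeads r γ y) b * c b := fun b => by
    rw [setIntegral_congr_fun (hE.inter (hT b)) (hval b), setIntegral_const,
      H.real_historySet_inter_toss hr, smul_eq_mul]
  obtain ⟨C, hC⟩ := H.exists_abs_increment_le hr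
  have hint : Integrable (increment r γ capital n) P :=
    Integrable.of_bound (H.measurable_increment n).aestronglyMeasurable C
      (Eventually.of_forall (hC n))
  have hdiff : E \ toss n ⁻¹' {true} = E ∩ toss n ⁻¹' {false} := by
    ext ω
    refine and_congr_right fun _ => ?_
    change ¬ toss n ω = true ↔ toss n ω = false
    simp
  rw [← integral_inter_add_sdiff (hT true) hint.integrableOn, hdiff, hpart, hpart]
  have hp := poisson_equation hr hγ0 hγ1 y
  -- The conditional mean of the increment is exactly the defect in the Poisson equation at `y`.
  have : tossProb (mixHeads r γ y) true * c true + tossProb (mixHeads r γ y) false * c false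
      = 0 := by
    simp only [c, tossProb, profit, if_true, Bool.false_eq_true, if_false, Int.cast_one,
      Int.cast_neg, ← sub_eq_add_neg]
    linear_combination hp
  linear_combination P.real E * this

/-- On each history of length `n` the past sum is constant, since it telescopes to a function of the
initial and current capital, while the next increment has integral zero. -/
theorem IsRandomMixture.integral_sum_mul_increment [IsProbabilityMeasure P] (hr : 3 ≤ r)
    (hγ0 : 0 < γ) (hγ1 : γ < 1) (H : IsRandomMixture r 0 γ P capital game toss) (n : ℕ) :
    ∫ ω, (∑ k ∈ Finset.range n, increment r γ capital k ω) * increment r γ capital n ω ∂P = 0 := by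
  -- The padding beyond `n` is arbitrary: `historySet` reads only indices below `n`.
  let ext : ℤ × (Fin n → Game × Bool) → ℕ → Game × Bool := fun a k =>
    if hk : k < n then a.2 ⟨k, hk⟩ else (Game.A, true)
  let E : ℤ × (Fin n → Game × Bool) → Set Ω := fun a =>
    historySet capital game toss n a.1 (fun k => (ext a k).1) (fun k => (ext a k).2)
  have hmem : ∀ a ω, ω ∈ E a ↔ (capital 0 ω, fun k : Fin n => (game k ω, toss k ω)) = a := by
    rintro ⟨x, a⟩ ω
    rw [Prod.mk.injEq, funext_iff]
    refine and_congr_right fun _ => ⟨fun h k => ?_, fun h k hk => ?_⟩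
    · have := h k k.2
      simp only [ext, k.2, dif_pos] at this
      exact Prod.ext this.1 this.2
    · have := h ⟨k, hk⟩
      simp only [ext, hk, dif_pos, ← this, and_self]
  have hE : ∀ a, MeasurableSet (E a) := fun a => H.measurableSet_historySet _ _ _ _
  have hdisj : Pairwise (Function.onFun Disjoint E) := fun a b hab =>
    Set.disjoint_left.2 fun ω ha hb => hab (((hmem a ω).1 ha).symm.trans ((hmem b ω).1 hb))
  have hcover : ⋃ a, E a = Set.univ :=
    Set.eq_univ_of_forall fun ω => Set.mem_iUnion.2 ⟨_, (hmem _ ω).2 rfl⟩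
  obtain ⟨C, hC⟩ := H.exists_abs_increment_le hr
  have hint : Integrable (fun ω => (∑ k ∈ Finset.range n, increment r γ capital k ω)
      * increment r γ capital n ω) P := by
    refine Integrable.of_bound ((Finset.measurable_fun_sum _ fun k _ =>
      H.measurable_increment k).mul (H.measurable_increment n)).aestronglyMeasurable (n * C * C)
      (Eventually.of_forall fun ω => ?_)
    have h1 := abs_sum_range_sub_le (d := fun k => increment r γ capital k ω)
      (fun k => hC k ω) 0 n
    rw [zero_add, Finset.range_zero, Finset.sum_empty, abs_zero, zero_add] at h1
    rw [Real.norm_eq_abs, abs_mul]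
    exact mul_le_mul h1 (hC n ω) (abs_nonneg _) ((abs_nonneg _).trans h1)
  rw [← setIntegral_univ, ← hcover, integral_iUnion hE hdisj hint.integrableOn]
  refine (tsum_congr fun a => ?_).trans tsum_zero
  let y : ℕ → ℤ := capitalAfter a.1 fun k => (ext a k).2
  have hconst : ∀ ω ∈ E a, (∑ k ∈ Finset.range n, increment r γ capital k ω)
      * increment r γ capital n ω = (((y n - y 0 : ℤ) : ℝ) + potential r γ (y n)
        - potential r γ (y 0) - n * rateFormula r γ) * increment r γ capital n ω := fun ω hω => by
    rw [sum_increment, H.capital_eq_capitalAfter hω le_rfl,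
      H.capital_eq_capitalAfter hω (Nat.zero_le n)]
  rw [setIntegral_congr_fun (hE a) hconst, integral_const_mul,
    H.setIntegral_increment hr hγ0 hγ1, mul_zero]

/-- The compensated sum differs from the profit minus `n` times the rate by a bounded change of
potential, which vanishes after division by `n`. -/
theorem IsRandomMixture.hasRateOfProfit [IsProbabilityMeasure P] (hr : 3 ≤ r)
    (hγ0 : 0 < γ) (hγ1 : γ < 1) (H : IsRandomMixture r 0 γ P capital game toss) :
    HasRateOfProfit P capital (rateFormula r γ) := by
  obtain ⟨C, hC⟩ := H.exists_abs_increment_le hr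
  obtain ⟨K, hK⟩ := exists_abs_potential_le hr γ
  filter_upwards [ae_tendsto_sum_range_div_of_orthogonal H.measurable_increment hC
    (H.integral_sum_mul_increment hr hγ0 hγ1)] with ω hω
  have hpot : Tendsto (fun n : ℕ => (potential r γ (capital 0 ω) - potential r γ (capital n ω))
      / (n : ℝ)) atTop (𝓝 0) := by
    refine squeeze_zero_norm (fun n => ?_) (tendsto_const_div_atTop_nhds_zero_nat (K + K))
    rw [Real.norm_eq_abs, abs_div, Nat.abs_cast]
    gcongr
    exact (abs_sub _ _).trans (add_le_add (hK _) (hK _))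
  have h := (hω.add hpot).add_const (rateFormula r γ)
  rw [zero_add, zero_add] at h
  refine h.congr' ?_
  filter_upwards [eventually_ge_atTop 1] with n hn
  have hn' : (n : ℝ) ≠ 0 := by positivity
  rw [sum_increment]
  field_simp
  ring

end Walk

end Parrondo

theorem theorem4 (r : ℕ) (hr : 3 ≤ r) (γ : ℝ) (hγ0 : 0 < γ) (hγ1 : γ < 1) :
    (∃ π : Fin r → ℝ, Parrondo.IsStationary (Parrondo.mixtureMatrix r 0 γ) π ∧
      (∀ π' : Fin r → ℝ, Parrondo.IsStationary (Parrondo.mixtureMatrix r 0 γ) π' → π' = π) ∧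
      Parrondo.meanProfit r 0 γ π = Parrondo.rateFormula r γ) ∧
    ∀ (Ω : Type*) [MeasurableSpace Ω] (P : Measure Ω) [IsProbabilityMeasure P]
      (capital : ℕ → Ω → ℤ) (game : ℕ → Ω → Parrondo.Game) (toss : ℕ → Ω → Bool),
      Parrondo.IsRandomMixture r 0 γ P capital game toss →
        Parrondo.HasRateOfProfit P capital (Parrondo.rateFormula r γ) := by
  have : NeZero r := ⟨by omega⟩
  obtain ⟨π, hπ, huniq⟩ := Parrondo.exists_unique_isStationary
    (Parrondo.mixtureMatrix_nonneg hr hγ0 hγ1) (Parrondo.mixtureMatrix_row_sum hr γ)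
    (Parrondo.mixtureMatrix_harmonic hr hγ0 hγ1)
  exact ⟨⟨π, hπ, huniq, Parrondo.meanProfit_eq_rateFormula hr hγ0 hγ1 hπ⟩,
    fun Ω _ P _ capital game toss H => H.hasRateOfProfit hr hγ0 hγ1⟩
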